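/- Let $b\ge a\ge 0$ be integers. Let $\mathcal I_{a+b}(321)$ be the set of involutions $\pi$ of $\{1,\dots,a+b\}$ (permutations with $\pi\circ\pi=\mathrm{id}$, the identity included) that avoid the pattern $321$, i.e. for which there are no $i<j<k$ with $\pi(i)>\pi(j)>\pi(k)$. Let $\mathrm{fp}(\pi)$ be the number of fixed points of $\pi$, and let $\mathrm{Des}(\pi)=\{i : 1\le i<a+b,\ \pi(i)>\pi(i+1)\}$ be its descent set. Let $\mathcal Y_{a,b}$ be the set of Young diagrams that fit in the rectangle with $a$ rows and $b$ columns. For a Young diagram $\lambda$ with row lengths $\lambda_1\ge\lambda_2\ge\cdots$, let $k$ be the side of its Durfee square, that is, the largest $k\ge 0$ such that $k=0$ or $\lambda_k\ge k$. The hook decomposition $\mathrm{hd}(\lambda)=\{i_1<\dots<i_k\}$ is obtained by peeling off hooks: $i_k$ is the number of boxes in the largest hook of $\lambda$, which consists of its first row and first column; after removing this hook, $i_{k-1}$ is the number of boxes in the largest hook of the remaining diagram, and so on. Then there is a bijection $$\theta:\{\pi\in\mathcal I_{a+b}(321):\mathrm{fp}(\pi)\ge b-a\}\longrightarrow\mathcal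 Y_{a,b}$$ such that $\mathrm{Des}(\pi)=\mathrm{hd}(\theta(\pi))$ for every $\pi$ in the domain. -/

import Mathlib

/-! ### Permutation statistics -/

/-- The permutation `π` of `m` letters contains the pattern `τ` if some subsequence of
`π` has its entries in the same relative order as `τ`. -/
def ContainsPattern {m k : ℕ} (π : Equiv.Perm (Fin m)) (τ : Equiv.Perm (Fin k)) : Prop :=
  ∃ f : Fin k → Fin m, StrictMono f ∧ ∀ i j : Fin k, π (f i) < π (f j) ↔ τ i < τ j

/-- The pattern `321`, that is, the order reversing permutation of three letters. -/
def pattern321 : Equiv.Perm (Fin 3) := Fin.revPerm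

/-- The `321`-avoiding involutions of `m` letters (the identity counts as an involution). -/
def avoidingInvolutions (m : ℕ) : Set (Equiv.Perm (Fin m)) :=
  {π | Function.Involutive π ∧ ¬ ContainsPattern π pattern321}

/-- The number of fixed points of `π`. -/
def fixedPointCount {m : ℕ} (π : Equiv.Perm (Fin m)) : ℕ :=
  (Finset.univ.filter fun i : Fin m => π i = i).card

/-- The descent set of `π`. Positions are numbered from `1`: the letter `j : Fin m` stands in
position `j + 1`, so the position `p` is a descent if the letter in position `p`
(index `p - 1`) has a larger image than the letter in position `p + 1` (index `p`). -/
def descentSet {m : ℕ} (π : Equiv.Perm (Fin m)) : Set ℕ :=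
  {p | ∃ j k : Fin m, (j : ℕ) + 1 = p ∧ (k : ℕ) = p ∧ π k < π j}

/-! ### Young diagrams: cells are pairs (row, column), numbered from `0` -/

/-- The Young diagrams that fit in the rectangle with `a` rows and `b` columns. -/
def diagramsInRectangle (a b : ℕ) : Set YoungDiagram :=
  {μ | ∀ c ∈ μ, c.1 < a ∧ c.2 < b}

/-- The number of boxes in the largest hook of `μ`, which consists of the first row and the
first column. -/
def largestHookSize (μ : YoungDiagram) : ℕ :=
  (μ.cells.filter fun c => c.1 = 0 ∨ c.2 = 0).card

/-- The diagram left after the largest hook of `μ` has been removed, moved back to the corner: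
`(i, j)` is one of its boxes exactly when `(i + 1, j + 1)` is a box of `μ`. -/
def removeLargestHook (μ : YoungDiagram) : YoungDiagram where
  cells := μ.cells.filter fun c => (c.1 + 1, c.2 + 1) ∈ μ
  isLowerSet := by
    rintro ⟨i, j⟩ ⟨i', j'⟩ h hc
    have h1 : i' ≤ i := h.1
    have h2 : j' ≤ j := h.2
    simp only [Finset.coe_filter, Set.mem_ofPred_eq, YoungDiagram.mem_cells] at hc ⊢
    exact ⟨μ.up_left_mem h1 h2 hc.1,
      μ.up_left_mem (Nat.succ_le_succ h1) (Nat.succ_le_succ h2) hc.2⟩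

theorem mem_removeLargestHook (μ : YoungDiagram) (i j : ℕ) :
    (i, j) ∈ removeLargestHook μ ↔ (i + 1, j + 1) ∈ μ := by
  rw [← YoungDiagram.mem_cells]
  simp only [removeLargestHook, Finset.mem_filter, YoungDiagram.mem_cells]
  exact ⟨fun h => h.2, fun h => ⟨μ.up_left_mem (Nat.le_succ i) (Nat.le_succ j) h, h⟩⟩

/-- The side of the Durfee square of `μ`: the largest `k` such that `k = 0` or the `k`-th row
(row `k - 1` when rows are numbered from `0`) has at least `k` boxes. Such a `k` is at most the
number of rows. -/
def durfeeSide (μ : YoungDiagram) : ℕ :=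
  Nat.findGreatest (fun k => k ≤ μ.rowLen (k - 1)) (μ.colLen 0)

/-- The hook decomposition of `μ`: the sizes of the hooks that are peeled off when the largest
hook is removed repeatedly, as many times as the side of the Durfee square tells. -/
def hookDecomposition (μ : YoungDiagram) : Set ℕ :=
  {n | ∃ j < durfeeSide μ, n = largestHookSize (removeLargestHook^[j] μ)}

/-! Both sides are compared with words of `a` down and `b` up letters, whose statistic is the set of
peaks (an up letter followed by a down letter).

Words and diagrams satisfy the same recursion. Cutting a word at its last peak leaves a prefix with
some `β < a` down and `α < b` up letters and a peak at `α + β + 1`. Removing the largest hook of a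
nonempty diagram, with leg `β` and arm `α`, removes `α + β + 1` boxes and leaves a diagram in the
`β` by `α` rectangle. In both cases any smaller object may occur, and just one object has empty
statistic. `HasHookRecursion.exists_equiv` then builds the bijection by induction.

A `321`-avoiding involution is determined by its openers (points moved up) and closers (points moved
down): the `i`-th opener is exchanged with the `i`-th closer, and no fixed point lies under an arc.
Its descents are the openers directly followed by a closer. Write openers as up letters, closers as
down letters, and the fixed points from left to right as down letters and then up letters, with `a`
down letters in all. This is possible because `fp ≥ b - a` means at most `a` closers, and it creates
no further peaks (`IsCompatible.peakSet_eq`). Conversely, each word has exactly one compatible pair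
of openers and closers (`exists_isCompatible`, `IsCompatible.unique`). -/

/-! ### Lattice words -/

/-- Words with `a` down letters and `b` up letters, encoded by the set of positions
(numbered from `0`) of the down letters. -/
def LatticeWord (a b : ℕ) : Type :=
  {D : Finset ℕ // D ⊆ Finset.range (a + b) ∧ D.card = a}

/-- The peaks of a word with set of down positions `D`: an up letter in position `p - 1`
followed by a down letter in position `p`. -/
def peakSet (D : Finset ℕ) : Set ℕ :=
  {p | ∃ q, p = q + 1 ∧ q ∉ D ∧ q + 1 ∈ D}

/-- The word obtained from a word `D` with `α` up letters and `β` down letters by appending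
an up letter, `a - β` down letters, and up letters from then on. -/
def appendPeak (a α β : ℕ) (D : Finset ℕ) : Finset ℕ :=
  D ∪ Finset.Ico (α + β + 1) (α + a + 1)

theorem mem_appendPeak {a α β : ℕ} {D : Finset ℕ} {x : ℕ} :
    x ∈ appendPeak a α β D ↔ x ∈ D ∨ α + β + 1 ≤ x ∧ x < α + a + 1 := by
  simp [appendPeak]

theorem peakSet_appendPeak {a α β : ℕ} {D : Finset ℕ} (hβ : β < a)
    (hD : ∀ x ∈ D, x < β + α) :
    peakSet (appendPeak a α β D) = insert (α + β + 1) (peakSet D) := by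
  ext p
  simp only [peakSet, Set.mem_insert_iff, Set.mem_ofPred_eq, mem_appendPeak]
  constructor
  · rintro ⟨q, rfl, h1, h2⟩
    rcases h2 with h2 | h2
    · exact Or.inr ⟨q, rfl, fun h => h1 (Or.inl h), h2⟩
    · left
      by_contra h
      exact h1 (Or.inr ⟨by omega, by omega⟩)
  · rintro (rfl | ⟨q, rfl, h1, h2⟩)
    · refine ⟨α + β, rfl, ?_, Or.inr ⟨by omega, by omega⟩⟩
      rintro (h | h)
      · have := hD _ h; omega
      · omega
    · refine ⟨q, rfl, ?_, Or.inl h2⟩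
      have := hD _ h2
      rintro (h | h)
      · exact h1 h
      · omega

theorem appendPeak_spec {a b α β : ℕ} {D : Finset ℕ} (hβ : β < a) (hα : α < b)
    (hD : D ⊆ Finset.range (β + α)) (hc : D.card = β) :
    appendPeak a α β D ⊆ Finset.range (a + b) ∧ (appendPeak a α β D).card = a := by
  constructor
  · intro x hx
    rw [mem_appendPeak] at hx
    rw [Finset.mem_range]
    rcases hx with hx | hx
    · have := Finset.mem_range.1 (hD hx); omega
    · omega
  · rw [appendPeak, Finset.card_union_of_disjoint, Nat.card_Ico, hc]
    · omega
    · rw [Finset.disjoint_left]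
      intro x hx hx'
      have := Finset.mem_range.1 (hD hx)
      have := Finset.mem_Ico.1 hx'
      omega

theorem peakSet_range (a : ℕ) : peakSet (Finset.range a) = ∅ := by
  ext p
  simp only [peakSet, Set.mem_ofPred_eq, Finset.mem_range, Set.mem_empty_iff_false, iff_false]
  rintro ⟨q, rfl, h1, h2⟩
  omega

theorem bddAbove_peakSet (D : Finset ℕ) : BddAbove (peakSet D) := by
  refine (D.finite_toSet.subset ?_).bddAbove
  rintro p ⟨q, rfl, -, h⟩
  exact h

/-- A set of naturals from `p` on that is closed under predecessors from `p` on is an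
interval that starts at `p`. -/
theorem mem_iff_lt_of_pred_mem {S : Finset ℕ} {p : ℕ} (hp : ∀ x ∈ S, p ≤ x)
    (h : ∀ x, p ≤ x → x + 1 ∈ S → x ∈ S) (x : ℕ) :
    x ∈ S ↔ p ≤ x ∧ x < p + S.card := by
  have down : ∀ d y, p ≤ y → y + d ∈ S → y ∈ S := by
    intro d
    induction d with
    | zero => exact fun y _ hy => hy
    | succ d ih => exact fun y hy hyd => ih y hy (h _ (by omega) hyd)
  have key : ∀ y ∈ S, y < p + S.card := by
    intro y hy
    have hsub : Finset.Ico p (y + 1) ⊆ S := by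
      intro z hz
      rw [Finset.mem_Ico] at hz
      exact down (y - z) z hz.1 (by rwa [show z + (y - z) = y by omega])
    have := Finset.card_le_card hsub
    have := hp y hy
    rw [Nat.card_Ico] at *
    omega
  have heq : S = Finset.Ico p (p + S.card) := by
    refine Finset.eq_of_subset_of_card_le ?_ (by simp)
    intro y hy
    exact Finset.mem_Ico.2 ⟨hp y hy, key y hy⟩
  constructor
  · exact fun hx => ⟨hp x hx, key x hx⟩
  · intro hx
    rw [heq]
    exact Finset.mem_Ico.2 hx

/-- A word without peaks consists of its down letters followed by its up letters. -/
theorem eq_range_of_peakSet_eq_empty {D : Finset ℕ} (h : peakSet D = ∅) :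
    D = Finset.range D.card := by
  ext x
  rw [mem_iff_lt_of_pred_mem (S := D) (p := 0) (by simp), Finset.mem_range]
  · simp
  · intro x _ hx
    by_contra hn
    exact (Set.eq_empty_iff_forall_notMem.1 h (x + 1)) ⟨x, rfl, hn, hx⟩

/-- A word with a peak arises by `appendPeak` from the part before its last peak. -/
theorem exists_appendPeak {a b : ℕ} {D : Finset ℕ} (hD : D ⊆ Finset.range (a + b))
    (hc : D.card = a) (h : (peakSet D).Nonempty) :
    ∃ α β, β < a ∧ α < b ∧ ∃ D' : Finset ℕ, D' ⊆ Finset.range (β + α) ∧ D'.card = β ∧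
      D = appendPeak a α β D' := by
  obtain ⟨p, hpD, hmax⟩ : ∃ p ∈ peakSet D, ∀ q ∈ peakSet D, q ≤ p :=
    ⟨sSup (peakSet D), Nat.sSup_mem h (bddAbove_peakSet D),
      fun q hq => le_csSup (bddAbove_peakSet D) hq⟩
  obtain ⟨q, rfl, hq, hq'⟩ := hpD
  set D' := D.filter (· < q) with hD'
  set T := D.filter (q + 1 ≤ ·) with hT
  have hsplit : D'.card + T.card = a := by
    rw [← hc, ← Finset.card_filter_add_card_filter_not (s := D) (· < q)]
    congr 2
    ext x
    simp only [hT, Finset.mem_filter, not_lt]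
    constructor
    · rintro ⟨h1, h2⟩; exact ⟨h1, by omega⟩
    · rintro ⟨h1, h2⟩
      refine ⟨h1, ?_⟩
      rcases Nat.lt_or_eq_of_le h2 with h3 | rfl
      · exact h3
      · exact absurd h1 hq
  -- A gap in `T` followed by a down letter would be a peak after the last one, so `T` is an
  -- interval.
  have hTmem : ∀ x, x ∈ T ↔ q + 1 ≤ x ∧ x < q + 1 + T.card := by
    refine mem_iff_lt_of_pred_mem (by simp [hT]) ?_
    intro x hx hx1
    simp only [hT, Finset.mem_filter] at hx1 ⊢
    refine ⟨?_, hx⟩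
    by_contra hn
    have := hmax (x + 1) ⟨x, rfl, hn, hx1.1⟩
    omega
  have hTpos : 0 < T.card := Finset.card_pos.2 ⟨q + 1, by simp [hT, hq']⟩
  have hle : D'.card ≤ q := by
    have : D' ⊆ Finset.range q := fun x hx => by simpa using (Finset.mem_filter.1 hx).2
    simpa using Finset.card_le_card this
  have hlast : q + T.card < a + b := by
    have : q + T.card ∈ T := (hTmem _).2 ⟨by omega, by omega⟩
    exact Finset.mem_range.1 (hD (Finset.mem_filter.1 this).1)
  refine ⟨q - D'.card, D'.card, by omega, by omega, D', ?_, rfl, ?_⟩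
  · intro x hx
    rw [Finset.mem_range]
    have := (Finset.mem_filter.1 hx).2
    omega
  · ext x
    rw [mem_appendPeak]
    have h1 : q - D'.card + D'.card + 1 = q + 1 := by omega
    have h2 : q - D'.card + a + 1 = q + 1 + T.card := by omega
    rw [h1, h2, ← hTmem]
    simp only [hD', hT, Finset.mem_filter]
    constructor
    · intro hx
      rcases Nat.lt_trichotomy x q with h | rfl | h
      · exact Or.inl ⟨hx, h⟩
      · exact absurd hx hq
      · exact Or.inr ⟨hx, h⟩
    · rintro (h | h) <;> exact h.1

/-- The word reveals its data: its last down letter stands at `α + a`, and the last up letter before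
that at `α + β`. -/
theorem appendPeak_inj {a α β α' β' : ℕ} {D D' : Finset ℕ} (hβ : β < a) (hβ' : β' < a)
    (hD : ∀ x ∈ D, x < β + α) (hD' : ∀ x ∈ D', x < β' + α')
    (h : appendPeak a α β D = appendPeak a α' β' D') : α = α' ∧ β = β' ∧ D = D' := by
  have hmem : ∀ x, (x ∈ D ∨ α + β + 1 ≤ x ∧ x < α + a + 1) ↔
      (x ∈ D' ∨ α' + β' + 1 ≤ x ∧ x < α' + a + 1) := by
    intro x
    rw [← mem_appendPeak, ← mem_appendPeak, h]
  have hlast : α = α' := by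
    have h1 := (hmem (α + a)).1 (Or.inr ⟨by omega, by omega⟩)
    have h2 := (hmem (α' + a)).2 (Or.inr ⟨by omega, by omega⟩)
    have h3 := hD (α' + a)
    have h4 := hD' (α + a)
    grind
  subst hlast
  have hp : β = β' := by
    have h1 := hmem (α + β)
    have h2 := hmem (α + β')
    have h3 := hD (α + β)
    have h4 := hD' (α + β)
    have h5 := hD (α + β')
    have h6 := hD' (α + β')
    grind
  subst hp
  refine ⟨rfl, rfl, ?_⟩
  ext x
  have h1 := hmem x
  have h2 := hD x
  have h3 := hD' x
  grind

/-! ### Hooks of Young diagrams -/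

/-- In terms of diagonal cells, removing a hook is just a shift of the index `j`, which gives the
recursion for `hookDecomposition`. -/
theorem lt_durfeeSide_iff (μ : YoungDiagram) (j : ℕ) : j < durfeeSide μ ↔ (j, j) ∈ μ := by
  have hP : ∀ k, k + 1 ≤ μ.rowLen k ↔ (k, k) ∈ μ := fun k => YoungDiagram.mem_iff_lt_rowLen.symm
  constructor
  · intro h
    obtain ⟨d, hd⟩ : ∃ d, durfeeSide μ = d + 1 := ⟨durfeeSide μ - 1, by omega⟩
    have hs : durfeeSide μ ≤ μ.rowLen (durfeeSide μ - 1) :=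
      Nat.findGreatest_of_ne_zero (P := fun k => k ≤ μ.rowLen (k - 1)) (n := μ.colLen 0)
        (m := durfeeSide μ) rfl (by omega)
    rw [hd, Nat.add_sub_cancel, hP] at hs
    exact μ.up_left_mem (by omega) (by omega) hs
  · intro h
    refine Nat.lt_of_succ_le (Nat.le_findGreatest ?_ ?_)
    · have : (j, 0) ∈ μ := μ.up_left_mem le_rfl (Nat.zero_le _) h
      exact YoungDiagram.mem_iff_lt_colLen.1 this
    · exact (hP j).2 h

theorem hookDecomposition_eq (μ : YoungDiagram) :
    hookDecomposition μ =
      {n | ∃ j, (j, j) ∈ μ ∧ n = largestHookSize (removeLargestHook^[j] μ)} := by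
  ext n
  simp only [hookDecomposition, lt_durfeeSide_iff, Set.mem_ofPred_eq]

theorem hookDecomposition_bot : hookDecomposition ⊥ = ∅ := by
  ext n
  simp [hookDecomposition_eq]

theorem hookDecomposition_of_mem {μ : YoungDiagram} (h : (0, 0) ∈ μ) :
    hookDecomposition μ =
      insert (largestHookSize μ) (hookDecomposition (removeLargestHook μ)) := by
  ext n
  simp only [hookDecomposition_eq, Set.mem_insert_iff, Set.mem_ofPred_eq, mem_removeLargestHook]
  constructor
  · rintro ⟨j, hj, rfl⟩
    cases j with
    | zero => exact Or.inl rfl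
    | succ j => exact Or.inr ⟨j, hj, rfl⟩
  · rintro (rfl | ⟨j, hj, rfl⟩)
    · exact ⟨0, h, rfl⟩
    · exact ⟨j + 1, hj, rfl⟩

/-- The cells of the diagram with first row of `α + 1` boxes, first column of `β + 1` boxes,
and the rest given by `μ`. -/
def hookCells (α β : ℕ) (μ : YoungDiagram) : Finset (ℕ × ℕ) :=
  (Finset.range (β + 1) ×ˢ Finset.range (α + 1)).filter
    fun c => c.1 = 0 ∨ c.2 = 0 ∨ (c.1 - 1, c.2 - 1) ∈ μ

/-- The diagram with first row of `α + 1` boxes, first column of `β + 1` boxes, and the rest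
given by the part of `μ` in the rectangle with `β` rows and `α` columns. -/
def addHook (α β : ℕ) (μ : YoungDiagram) : YoungDiagram where
  cells := hookCells α β μ
  isLowerSet := by
    rintro ⟨i, j⟩ ⟨i', j'⟩ h hc
    have h1 : i' ≤ i := h.1
    have h2 : j' ≤ j := h.2
    simp only [hookCells, Finset.coe_filter, Set.mem_ofPred_eq, Finset.mem_product,
      Finset.mem_range] at hc ⊢
    refine ⟨⟨by omega, by omega⟩, ?_⟩
    rcases hc.2 with h0 | h0 | h0
    · left; omega
    · right; left; omega
    · exact Or.inr (Or.inr (μ.up_left_mem (by omega) (by omega) h0))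

theorem mem_addHook {α β : ℕ} {μ : YoungDiagram} {i j : ℕ} :
    (i, j) ∈ addHook α β μ ↔
      (i ≤ β ∧ j ≤ α) ∧ (i = 0 ∨ j = 0 ∨ (i - 1, j - 1) ∈ μ) := by
  rw [← YoungDiagram.mem_cells]
  simp [addHook, hookCells]

theorem removeLargestHook_addHook {α β : ℕ} {μ : YoungDiagram}
    (hμ : μ ∈ diagramsInRectangle β α) : removeLargestHook (addHook α β μ) = μ := by
  ext ⟨i, j⟩
  rw [YoungDiagram.mem_cells, YoungDiagram.mem_cells, mem_removeLargestHook, mem_addHook]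
  constructor
  · rintro ⟨-, h⟩
    simpa using h
  · intro h
    have := hμ _ h
    exact ⟨⟨this.1, this.2⟩, Or.inr (Or.inr (by simpa using h))⟩

theorem largestHookSize_addHook (α β : ℕ) (μ : YoungDiagram) :
    largestHookSize (addHook α β μ) = α + β + 1 := by
  have : (addHook α β μ).cells.filter (fun c => c.1 = 0 ∨ c.2 = 0) =
      (Finset.range (α + 1)).image (fun j => ((0 : ℕ), j)) ∪
        (Finset.range β).image (fun i => (i + 1, (0 : ℕ))) := by
    ext ⟨i, j⟩
    rw [Finset.mem_filter, YoungDiagram.mem_cells, mem_addHook]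
    simp only [Finset.mem_union, Finset.mem_image, Finset.mem_range, Prod.mk.injEq]
    constructor
    · rintro ⟨⟨h1, h2⟩, h3⟩
      rcases Nat.eq_zero_or_pos i with rfl | hi
      · exact Or.inl ⟨j, by omega, rfl, rfl⟩
      · exact Or.inr ⟨i - 1, by omega, by omega, by omega⟩
    · rintro (⟨j', h, rfl, rfl⟩ | ⟨i', h, rfl, rfl⟩)
      · exact ⟨⟨⟨by omega, by omega⟩, Or.inl rfl⟩, Or.inl rfl⟩
      · exact ⟨⟨⟨by omega, by omega⟩, Or.inr (Or.inl rfl)⟩, Or.inr rfl⟩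
  rw [largestHookSize, this, Finset.card_union_of_disjoint,
    Finset.card_image_of_injective, Finset.card_image_of_injective, Finset.card_range,
    Finset.card_range]
  · omega
  · intro x y h; simpa using h
  · intro x y h; simpa using h
  · rw [Finset.disjoint_left]
    intro x hx hx'
    simp only [Finset.mem_image] at hx hx'
    obtain ⟨_, _, rfl⟩ := hx
    obtain ⟨_, _, h⟩ := hx'
    simp at h

theorem hookDecomposition_addHook {α β : ℕ} {μ : YoungDiagram}
    (hμ : μ ∈ diagramsInRectangle β α) :
    hookDecomposition (addHook α β μ) = insert (α + β + 1) (hookDecomposition μ) := by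
  rw [hookDecomposition_of_mem (mem_addHook.2 ⟨⟨Nat.zero_le _, Nat.zero_le _⟩, Or.inl rfl⟩),
    largestHookSize_addHook, removeLargestHook_addHook hμ]

theorem addHook_mem {a b α β : ℕ} (hβ : β < a) (hα : α < b) (μ : YoungDiagram) :
    addHook α β μ ∈ diagramsInRectangle a b := by
  rintro ⟨i, j⟩ h
  have := (mem_addHook.1 h).1
  exact ⟨by dsimp only; omega, by dsimp only; omega⟩

theorem addHook_inj {α β α' β' : ℕ} {μ μ' : YoungDiagram}
    (hμ : μ ∈ diagramsInRectangle β α) (hμ' : μ' ∈ diagramsInRectangle β' α')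
    (h : addHook α β μ = addHook α' β' μ') : α = α' ∧ β = β' ∧ μ = μ' := by
  have hmem : ∀ i j, (i, j) ∈ addHook α β μ ↔ (i, j) ∈ addHook α' β' μ' := by simp [h]
  -- The ends of the first row and of the first column recover `α` and `β`.
  have h1 := hmem 0 α
  have h2 := hmem 0 α'
  have h3 := hmem β 0
  have h4 := hmem β' 0
  simp only [mem_addHook, true_or, or_true, and_true, le_refl, Nat.zero_le, true_and,
    true_iff, iff_true] at h1 h2 h3 h4
  refine ⟨by omega, by omega, ?_⟩
  rw [← removeLargestHook_addHook hμ, h, removeLargestHook_addHook hμ']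

theorem exists_addHook {a b : ℕ} {μ : YoungDiagram} (hμ : μ ∈ diagramsInRectangle a b)
    (h : μ ≠ ⊥) :
    ∃ α β, β < a ∧ α < b ∧ ∃ ν ∈ diagramsInRectangle β α, μ = addHook α β ν := by
  have h0 : (0, 0) ∈ μ := by
    by_contra hn
    refine h ?_
    ext ⟨i, j⟩
    simp only [YoungDiagram.mem_cells, YoungDiagram.notMem_bot, iff_false]
    exact fun hc => hn (μ.up_left_mem (Nat.zero_le _) (Nat.zero_le _) hc)
  have hr : 0 < μ.rowLen 0 := YoungDiagram.mem_iff_lt_rowLen.1 h0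
  have hc : 0 < μ.colLen 0 := YoungDiagram.mem_iff_lt_colLen.1 h0
  have hrow : (0, μ.rowLen 0 - 1) ∈ μ := YoungDiagram.mem_iff_lt_rowLen.2 (by omega)
  have hcol : (μ.colLen 0 - 1, 0) ∈ μ := YoungDiagram.mem_iff_lt_colLen.2 (by omega)
  have hbd : ∀ i j, (i, j) ∈ μ → i < μ.colLen 0 ∧ j < μ.rowLen 0 := by
    intro i j hij
    exact ⟨YoungDiagram.mem_iff_lt_colLen.1 (μ.up_left_mem le_rfl (Nat.zero_le _) hij),
      YoungDiagram.mem_iff_lt_rowLen.1 (μ.up_left_mem (Nat.zero_le _) le_rfl hij)⟩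
  refine ⟨μ.rowLen 0 - 1, μ.colLen 0 - 1, (hμ _ hcol).1, (hμ _ hrow).2,
    removeLargestHook μ, ?_, ?_⟩
  · rintro ⟨i, j⟩ hij
    have := hbd _ _ ((mem_removeLargestHook μ i j).1 hij)
    exact ⟨by dsimp only; omega, by dsimp only; omega⟩
  · ext ⟨i, j⟩
    rw [YoungDiagram.mem_cells, YoungDiagram.mem_cells, mem_addHook, mem_removeLargestHook]
    constructor
    · intro hij
      have := hbd _ _ hij
      refine ⟨by omega, ?_⟩
      by_cases hi : i = 0
      · exact Or.inl hi
      by_cases hj : j = 0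
      · exact Or.inr (Or.inl hj)
      refine Or.inr (Or.inr ?_)
      rwa [Nat.sub_add_cancel (by omega), Nat.sub_add_cancel (by omega)]
    · rintro ⟨⟨h1, h2⟩, h3⟩
      by_cases hi : i = 0
      · subst hi
        exact YoungDiagram.mem_iff_lt_rowLen.2 (by omega)
      by_cases hj : j = 0
      · subst hj
        exact YoungDiagram.mem_iff_lt_colLen.2 (by omega)
      rcases h3 with h3 | h3 | h3
      · exact absurd h3 hi
      · exact absurd h3 hj
      · rwa [Nat.sub_add_cancel (by omega), Nat.sub_add_cancel (by omega)] at h3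

/-! ### Words and diagrams -/

/-- A family of sets of objects with a set-valued statistic, in which an object in `X a b` is
either the unique one with empty statistic or arises in a unique way from an object
in a smaller `X β α`, its statistic being extended by `α + β + 1`. -/
def HasHookRecursion (X : ℕ → ℕ → Type) (stat : ∀ a b, X a b → Set ℕ) : Prop :=
  ∀ a b, ∃ e : Option (Σ p : Fin a × Fin b, X p.1 p.2) ≃ X a b,
    stat a b (e none) = ∅ ∧
      ∀ p x, stat a b (e (some ⟨p, x⟩)) = insert ((p.2 : ℕ) + p.1 + 1) (stat p.1 p.2 x)

/-- The number of rows drops strictly, so the bijections for smaller rectangles can be glued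
together; `b` must vary in the induction. -/
theorem HasHookRecursion.exists_equiv {X Y : ℕ → ℕ → Type} {s : ∀ a b, X a b → Set ℕ}
    {t : ∀ a b, Y a b → Set ℕ} (hX : HasHookRecursion X s) (hY : HasHookRecursion Y t)
    (a b : ℕ) : ∃ e : X a b ≃ Y a b, ∀ x, s a b x = t a b (e x) := by
  induction a using Nat.strong_induction_on generalizing b with
  | _ a ih =>
    obtain ⟨f, hf0, hf⟩ := hX a b
    obtain ⟨g, hg0, hg⟩ := hY a b
    choose e he using fun p : Fin a × Fin b => ih p.1 p.1.2 p.2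
    refine ⟨f.symm.trans ((Equiv.optionCongr (Equiv.sigmaCongrRight e)).trans g), fun x => ?_⟩
    obtain ⟨y, rfl⟩ := f.surjective x
    rcases y with _ | ⟨p, y⟩
    · simp [hf0, hg0]
    · simp [hf, hg, he]

theorem hasHookRecursion_word : HasHookRecursion LatticeWord fun _ _ D => peakSet D.1 := by
  intro a b
  let F : Option (Σ p : Fin a × Fin b, LatticeWord p.1 p.2) → LatticeWord a b
    | none => ⟨Finset.range a, by simp, by simp⟩
    | some ⟨p, D⟩ => ⟨appendPeak a p.2 p.1 D.1,
        appendPeak_spec p.1.2 p.2.2 D.2.1 D.2.2⟩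
  have hpk : ∀ p x, peakSet (F (some ⟨p, x⟩)).1 =
      insert ((p.2 : ℕ) + p.1 + 1) (peakSet x.1) := fun p x =>
    peakSet_appendPeak p.1.2 fun y hy => Finset.mem_range.1 (x.2.1 hy)
  have hF : Function.Bijective F := by
    constructor
    · rintro (_ | ⟨⟨p, q⟩, D⟩) (_ | ⟨⟨p', q'⟩, D'⟩) h
      · rfl
      · have := hpk (p', q') D'
        rw [← h] at this
        exact absurd (this.symm.trans (peakSet_range a)) (Set.insert_nonempty _ _).ne_empty
      · have := hpk (p, q) D
        rw [h] at this
        exact absurd (this.symm.trans (peakSet_range a)) (Set.insert_nonempty _ _).ne_empty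
      · obtain ⟨h1, h2, h3⟩ := appendPeak_inj p.2 p'.2
          (fun y hy => Finset.mem_range.1 (D.2.1 hy))
          (fun y hy => Finset.mem_range.1 (D'.2.1 hy)) (congrArg Subtype.val h)
        obtain rfl := Fin.ext h1
        obtain rfl := Fin.ext h2
        obtain rfl := Subtype.ext h3
        rfl
    · rintro ⟨D, hD, hc⟩
      rcases Set.eq_empty_or_nonempty (peakSet D) with h | h
      · refine ⟨none, Subtype.ext ?_⟩
        have := eq_range_of_peakSet_eq_empty h
        rw [hc] at this
        exact this.symm
      · obtain ⟨α, β, hβ, hα, D', h1, h2, h3⟩ := exists_appendPeak hD hc h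
        exact ⟨some ⟨(⟨β, hβ⟩, ⟨α, hα⟩), ⟨D', h1, h2⟩⟩, Subtype.ext h3.symm⟩
  exact ⟨Equiv.ofBijective F hF, peakSet_range a, hpk⟩

theorem hasHookRecursion_diagram :
    HasHookRecursion (fun a b => {μ : YoungDiagram // μ ∈ diagramsInRectangle a b})
      fun _ _ μ => hookDecomposition μ.1 := by
  intro a b
  let F : Option (Σ p : Fin a × Fin b,
      {μ : YoungDiagram // μ ∈ diagramsInRectangle (p.1 : ℕ) (p.2 : ℕ)}) →
      {μ : YoungDiagram // μ ∈ diagramsInRectangle a b}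
    | none => ⟨⊥, fun c hc => absurd hc (YoungDiagram.notMem_bot c)⟩
    | some ⟨p, μ⟩ => ⟨addHook p.2 p.1 μ.1, addHook_mem p.1.2 p.2.2 μ.1⟩
  have hhd : ∀ p x, hookDecomposition (F (some ⟨p, x⟩)).1 =
      insert ((p.2 : ℕ) + p.1 + 1) (hookDecomposition x.1) := fun p x =>
    hookDecomposition_addHook x.2
  have hF : Function.Bijective F := by
    constructor
    · rintro (_ | ⟨⟨p, q⟩, D⟩) (_ | ⟨⟨p', q'⟩, D'⟩) h
      · rfl
      · have := hhd (p', q') D'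
        rw [← h] at this
        exact absurd (this.symm.trans hookDecomposition_bot) (Set.insert_nonempty _ _).ne_empty
      · have := hhd (p, q) D
        rw [h] at this
        exact absurd (this.symm.trans hookDecomposition_bot) (Set.insert_nonempty _ _).ne_empty
      · obtain ⟨h1, h2, h3⟩ := addHook_inj D.2 D'.2 (congrArg Subtype.val h)
        obtain rfl := Fin.ext h1
        obtain rfl := Fin.ext h2
        obtain rfl := Subtype.ext h3
        rfl
    · rintro ⟨μ, hμ⟩
      by_cases h : μ = ⊥
      · exact ⟨none, Subtype.ext h.symm⟩
      · obtain ⟨α, β, hβ, hα, ν, h1, h2⟩ := exists_addHook hμ h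
        exact ⟨some ⟨(⟨β, hβ⟩, ⟨α, hα⟩), ⟨ν, h1⟩⟩, Subtype.ext h2.symm⟩
  exact ⟨Equiv.ofBijective F hF, hookDecomposition_bot, hhd⟩

/-! ### Counting below a bound -/

/-- The number of elements of `S` below `j`. -/
def countBelow (S : Finset ℕ) (j : ℕ) : ℕ := (S.filter (· < j)).card

theorem countBelow_eq_count (S : Finset ℕ) (j : ℕ) :
    countBelow S j = Nat.count (· ∈ S) j := by
  rw [Nat.count_eq_card_filter_range, countBelow]
  congr 1
  ext x
  simp [and_comm]

theorem countBelow_zero (S : Finset ℕ) : countBelow S 0 = 0 := by simp [countBelow]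

theorem countBelow_succ_of_mem {S : Finset ℕ} {j : ℕ} (h : j ∈ S) :
    countBelow S (j + 1) = countBelow S j + 1 := by
  rw [countBelow_eq_count, countBelow_eq_count, Nat.count_succ, if_pos h]

theorem countBelow_succ_of_notMem {S : Finset ℕ} {j : ℕ} (h : j ∉ S) :
    countBelow S (j + 1) = countBelow S j := by
  rw [countBelow_eq_count, countBelow_eq_count, Nat.count_succ, if_neg h, add_zero]

theorem countBelow_mono (S : Finset ℕ) {i j : ℕ} (h : i ≤ j) :
    countBelow S i ≤ countBelow S j :=
  Finset.card_le_card fun x hx => by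
    rw [Finset.mem_filter] at hx ⊢
    exact ⟨hx.1, by omega⟩

theorem countBelow_lt {S : Finset ℕ} {i j : ℕ} (hi : i ∈ S) (h : i < j) :
    countBelow S i < countBelow S j := by
  have := countBelow_succ_of_mem hi
  have := countBelow_mono S (show i + 1 ≤ j from h)
  omega

theorem countBelow_inj {S : Finset ℕ} {i j : ℕ} (hi : i ∈ S) (hj : j ∈ S)
    (h : countBelow S i = countBelow S j) : i = j := by
  rcases Nat.lt_trichotomy i j with hij | hij | hij
  · have := countBelow_lt hi hij; omega
  · exact hij
  · have := countBelow_lt hj hij; omega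

theorem countBelow_of_le {S : Finset ℕ} {n j : ℕ} (hS : S ⊆ Finset.range n) (h : n ≤ j) :
    countBelow S j = S.card := by
  rw [countBelow, Finset.filter_true_of_mem]
  intro x hx
  have := Finset.mem_range.1 (hS hx)
  omega

theorem countBelow_insert {S : Finset ℕ} {v : ℕ} (hv : v ∉ S) (j : ℕ) :
    countBelow (insert v S) j = countBelow S j + if v < j then 1 else 0 := by
  rw [countBelow, Finset.filter_insert]
  split_ifs
  · rw [Finset.card_insert_of_notMem (by simp [hv]), countBelow]
  · rfl

/-- A discrete intermediate value theorem: the count starts at `0` and grows by steps of at most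
one. -/
theorem exists_countBelow_eq (S : Finset ℕ) {k n : ℕ} (h : k ≤ countBelow S n) :
    ∃ j ≤ n, countBelow S j = k := by
  induction n with
  | zero => exact ⟨0, le_rfl, by rw [countBelow_zero] at *; omega⟩
  | succ n ih =>
    by_cases hk : k ≤ countBelow S n
    · obtain ⟨j, hj, hjk⟩ := ih hk
      exact ⟨j, by omega, hjk⟩
    · refine ⟨n + 1, le_rfl, ?_⟩
      by_cases hn : n ∈ S
      · rw [countBelow_succ_of_mem hn] at *; omega
      · rw [countBelow_succ_of_notMem hn] at *; omega

/-- The element of `T` that has as many elements of `T` below it as `x` has elements of `S`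
below it. -/
noncomputable def partner (S T : Finset ℕ) (x : ℕ) : ℕ :=
  Nat.nth (· ∈ T) (countBelow S x)

/-- Equal cardinalities keep the index within `T`, so `Nat.nth` never takes its default value. -/
theorem partner_spec {S T : Finset ℕ} (hc : S.card = T.card) {x : ℕ} (hx : x ∈ S) :
    partner S T x ∈ T ∧ countBelow T (partner S T x) = countBelow S x := by
  have hlt : countBelow S x < T.card := by
    rw [← hc]
    exact Finset.card_lt_card (Finset.filter_ssubset.2 ⟨x, hx, lt_irrefl x⟩)
  have hfin : ∀ hf : (Set.ofPred (· ∈ T)).Finite, countBelow S x < hf.toFinset.card := by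
    intro hf
    convert hlt
    ext y
    rw [Set.Finite.mem_toFinset, Set.mem_ofPred_eq]
  refine ⟨Nat.nth_mem _ hfin, ?_⟩
  rw [countBelow_eq_count T]
  exact Nat.count_nth hfin

/-! ### Ballot pairs -/

/-- The sets `O` of openers and `C` of closers of a nonnesting partial matching of
`{0, …, n - 1}` in which no unmatched point lies under an arc. -/
structure IsBallotPair (n : ℕ) (O C : Finset ℕ) : Prop where
  openers_sub : O ⊆ Finset.range n
  closers_sub : C ⊆ Finset.range n
  disj : ∀ x ∈ O, x ∉ C
  le : ∀ j, countBelow C j ≤ countBelow O j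
  fixed : ∀ j, j ∉ O → j ∉ C → countBelow O j = countBelow C j

/-- The condition `fixed` ranges over all naturals; at the unmatched point `n` it compares the full
counts. -/
theorem IsBallotPair.card_eq {n : ℕ} {O C : Finset ℕ} (h : IsBallotPair n O C) :
    O.card = C.card := by
  have hn : ∀ S ⊆ Finset.range n, n ∉ S := fun S hS hn => by
    simpa using hS hn
  rw [← countBelow_of_le h.openers_sub le_rfl, ← countBelow_of_le h.closers_sub le_rfl]
  exact h.fixed n (hn _ h.openers_sub) (hn _ h.closers_sub)

/-- The ballot pair `(O, C)` is compatible with the word with set of down positions `D`: closers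
are down, openers are up, and the down letters precede the up letters among the other
positions. -/
structure IsCompatible (n : ℕ) (D O C : Finset ℕ) : Prop extends IsBallotPair n O C where
  down_of_closer : C ⊆ D
  up_of_opener : ∀ x ∈ O, x ∉ D
  down_initial : ∀ x y, x < y → y ∈ D → y ∉ C → x ∉ O → x ∈ D

theorem IsCompatible.succ {n : ℕ} {D O C : Finset ℕ}
    (h : IsCompatible n D O C) : IsCompatible (n + 1) D O C where
  openers_sub := h.openers_sub.trans (Finset.range_mono (Nat.le_succ n))
  closers_sub := h.closers_sub.trans (Finset.range_mono (Nat.le_succ n))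
  disj := h.disj
  le := h.le
  fixed := h.fixed
  down_of_closer := h.down_of_closer
  up_of_opener := h.up_of_opener
  down_initial := h.down_initial

/-- The word is read from left to right. A new down letter becomes a closer if some earlier up
letter is not yet an opener, and the nearest such up letter becomes an opener; otherwise it stays
unmatched. -/
theorem exists_isCompatible (n : ℕ) {D : Finset ℕ} (hD : D ⊆ Finset.range n) :
    ∃ O C, IsCompatible n D O C := by
  induction n generalizing D with
  | zero =>
    have : D = ∅ := by simpa using hD
    subst this
    exact ⟨∅, ∅, ⟨by simp, by simp, by simp, by simp, by simp⟩, by simp, by simp, by simp⟩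
  | succ n ih =>
    by_cases hn : n ∈ D
    swap
    · have hD' : D ⊆ Finset.range n := by
        intro x hx
        have := Finset.mem_range.1 (hD hx)
        have : x ≠ n := by rintro rfl; exact hn hx
        rw [Finset.mem_range]; omega
      obtain ⟨O, C, h⟩ := ih hD'
      exact ⟨O, C, h.succ⟩
    have hD' : D.erase n ⊆ Finset.range n := by
      intro x hx
      have := Finset.mem_range.1 (hD (Finset.mem_of_mem_erase hx))
      have := Finset.ne_of_mem_erase hx
      rw [Finset.mem_range]; omega
    obtain ⟨O, C, h⟩ := ih hD'
    have hnO : n ∉ O := fun hx => by simpa using h.openers_sub hx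
    have hnC : n ∉ C := fun hx => by simpa using h.closers_sub hx
    set U := (Finset.range n).filter fun x => x ∉ D ∧ x ∉ O with hU
    rcases U.eq_empty_or_nonempty with hUe | hUn
    · have h' := h.succ
      refine ⟨O, C, h'.toIsBallotPair,
        h.down_of_closer.trans (Finset.erase_subset _ _), ?_, ?_⟩
      · intro x hx hxD
        refine h.up_of_opener x hx (Finset.mem_erase.2 ⟨?_, hxD⟩)
        rintro rfl; exact hnO hx
      · intro x y hxy hy _ hxO
        by_contra hxD
        have hyn := Finset.mem_range.1 (hD hy)
        have : x ∈ U := Finset.mem_filter.2 ⟨Finset.mem_range.2 (by omega), hxD, hxO⟩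
        rw [hUe] at this
        simp at this
    · set v := U.max' hUn with hv
      have hvU : v ∈ U := U.max'_mem hUn
      obtain ⟨hvn, hvD, hvO⟩ := Finset.mem_filter.1 hvU
      rw [Finset.mem_range] at hvn
      have hvmax : ∀ x < n, x ∉ D → x ∉ O → x ≤ v := fun x hx h1 h2 =>
        U.le_max' x (Finset.mem_filter.2 ⟨Finset.mem_range.2 hx, h1, h2⟩)
      have hvC : v ∉ C := fun hx => hvD (Finset.mem_of_mem_erase (h.down_of_closer hx))
      -- An unmatched down letter after the unmatched up letter `v` would violate `down_initial`.
      have hfix : ∀ x, v < x → x ∈ D → x ≠ n → x ∈ C := by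
        intro x hvx hx hxn
        by_contra hxC
        exact hvD (Finset.mem_of_mem_erase
          (h.down_initial v x hvx (Finset.mem_erase.2 ⟨hxn, hx⟩) hxC hvO))
      refine ⟨insert v O, insert n C, ⟨?_, ?_, ?_, ?_, ?_⟩, ?_, ?_, ?_⟩
      · refine Finset.insert_subset (Finset.mem_range.2 (by omega)) ?_
        exact h.openers_sub.trans (Finset.range_mono (Nat.le_succ n))
      · refine Finset.insert_subset (Finset.mem_range.2 (by omega)) ?_
        exact h.closers_sub.trans (Finset.range_mono (Nat.le_succ n))
      · intro x hx hx'
        rw [Finset.mem_insert] at hx hx'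
        rcases hx with hx | hx <;> rcases hx' with hx' | hx'
        · omega
        · exact hvC (hx ▸ hx')
        · exact hnO (hx' ▸ hx)
        · exact h.disj x hx hx'
      · intro j
        rw [countBelow_insert hvO, countBelow_insert hnC]
        have := h.le j
        split_ifs <;> omega
      · intro j hj hj'
        rw [Finset.mem_insert, not_or] at hj hj'
        rw [countBelow_insert hvO, countBelow_insert hnC]
        have := h.fixed j hj.2 hj'.2
        by_cases hjn : n < j
        · rw [if_pos hjn, if_pos (by omega)]; omega
        -- Every position strictly between `v` and `n` is matched, so `j` lies before `v`, where
        -- neither count changes.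
        · have hjv : j < v := by
            by_contra hjv
            by_cases hjD : j ∈ D
            · exact hj'.2 (hfix j (by omega) hjD hj'.1)
            · have := hvmax j (by omega) hjD hj.2
              omega
          rw [if_neg hjn, if_neg (by omega)]; omega
      · refine Finset.insert_subset hn ?_
        exact h.down_of_closer.trans (Finset.erase_subset _ _)
      · intro x hx hxD
        rcases Finset.mem_insert.1 hx with rfl | hx
        · exact hvD hxD
        · refine h.up_of_opener x hx (Finset.mem_erase.2 ⟨fun e => hnO (e ▸ hx), hxD⟩)
      · intro x y hxy hy hyC hxO
        rw [Finset.mem_insert, not_or] at hyC hxO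
        exact Finset.mem_of_mem_erase
          (h.down_initial x y hxy (Finset.mem_erase.2 ⟨hyC.1, hy⟩) hyC.2 hxO.2)

/-! ### Uniqueness of the ballot pair of a word -/

theorem countBelow_congr {S T : Finset ℕ} {j : ℕ} (h : ∀ x < j, x ∈ S ↔ x ∈ T) :
    countBelow S j = countBelow T j := by
  rw [countBelow, countBelow]
  congr 1
  ext x
  simp only [Finset.mem_filter]
  constructor
  · rintro ⟨h1, h2⟩; exact ⟨(h x h2).1 h1, h2⟩
  · rintro ⟨h1, h2⟩; exact ⟨(h x h2).2 h1, h2⟩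

/-- If `i` were unmatched in the second pair, `down_initial` would make every earlier opener of the
first pair an opener of the second. By `fixed`, there would then be too few openers before `i` for
the closers of the first pair up to and including `i`. -/
theorem IsCompatible.closer_of_closer {n : ℕ} {D O C O' C' : Finset ℕ}
    (h : IsCompatible n D O C) (h' : IsCompatible n D O' C') {i : ℕ}
    (hlt : ∀ x < i, x ∈ C ↔ x ∈ C') (hi : i ∈ C) : i ∈ C' := by
  by_contra hi'
  have hiD := h.down_of_closer hi
  have hiO' : i ∉ O' := fun hx => h'.up_of_opener i hx hiD
  have h1 := h'.fixed i hiO' hi'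
  have h2 := countBelow_congr hlt
  have h3 := h.le (i + 1)
  rw [countBelow_succ_of_mem hi,
    countBelow_succ_of_notMem fun hx => h.up_of_opener i hx hiD] at h3
  have h4 : countBelow O i ≤ countBelow O' i := by
    refine Finset.card_le_card fun x hx => ?_
    rw [Finset.mem_filter] at hx ⊢
    refine ⟨?_, hx.2⟩
    by_contra hxO'
    exact h.up_of_opener x hx.1 (h'.down_initial x i hx.2 hiD hi' hxO')
  omega

theorem countBelow_add_card_filter_le (S : Finset ℕ) (j : ℕ) :
    countBelow S j + (S.filter (j ≤ ·)).card = S.card := by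
  rw [countBelow, ← Finset.card_filter_add_card_filter_not (s := S) (· < j)]
  congr 3
  ext x
  simp

/-- Both opener sets have as many elements as `C` and agree after `i`. If only the first contains
`i`, the second has one more element before `i`, against `fixed` for the second and `le` for the
first. -/
theorem IsCompatible.opener_of_opener {n : ℕ} {D O O' C : Finset ℕ}
    (h : IsCompatible n D O C) (h' : IsCompatible n D O' C) {i : ℕ}
    (hgt : ∀ x, i < x → (x ∈ O ↔ x ∈ O')) (hi : i ∈ O) : i ∈ O' := by
  by_contra hi'
  have h1 := h'.fixed i hi' (h.disj i hi)
  have h2 := h.le i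
  have h3 := countBelow_add_card_filter_le O (i + 1)
  have h4 := countBelow_add_card_filter_le O' (i + 1)
  have h5 : O.filter (i + 1 ≤ ·) = O'.filter (i + 1 ≤ ·) := by
    ext x
    simp only [Finset.mem_filter]
    constructor
    · rintro ⟨h1, h2⟩; exact ⟨(hgt x h2).1 h1, h2⟩
    · rintro ⟨h1, h2⟩; exact ⟨(hgt x h2).2 h1, h2⟩
  rw [countBelow_succ_of_mem hi] at h3
  rw [countBelow_succ_of_notMem hi', ← h5] at h4
  have := h.card_eq
  have := h'.card_eq
  omega

theorem IsCompatible.unique {n : ℕ} {D O C O' C' : Finset ℕ}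
    (h : IsCompatible n D O C) (h' : IsCompatible n D O' C') : O = O' ∧ C = C' := by
  have hC : C = C' := by
    ext i
    induction i using Nat.strong_induction_on with
    | _ i ih =>
      exact ⟨h.closer_of_closer h' ih, h'.closer_of_closer h fun x hx => (ih x hx).symm⟩
  subst hC
  refine ⟨?_, rfl⟩
  -- Unlike the closers, the openers are compared from right to left.
  have key : ∀ d i, n ≤ i + d → (i ∈ O ↔ i ∈ O') := by
    intro d
    induction d with
    | zero =>
      intro i hi
      have h1 : i ∉ O := fun hx => by have := Finset.mem_range.1 (h.openers_sub hx); omega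
      have h2 : i ∉ O' := fun hx => by have := Finset.mem_range.1 (h'.openers_sub hx); omega
      simp [h1, h2]
    | succ d ih =>
      intro i hi
      have hgt : ∀ x, i < x → (x ∈ O ↔ x ∈ O') := fun x hx => ih x (by omega)
      exact ⟨h.opener_of_opener h' hgt, h'.opener_of_opener h fun x hx => (hgt x hx).symm⟩
  ext i
  exact key n i (by omega)

/-- On the unmatched positions both down sets are initial segments, so one word contains the other.
-/
theorem IsCompatible.word_unique {n : ℕ} {D D' O C : Finset ℕ}
    (h : IsCompatible n D O C) (h' : IsCompatible n D' O C) (hc : D.card = D'.card) :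
    D = D' := by
  by_cases hsub : D ⊆ D'
  · exact Finset.eq_of_subset_of_card_le hsub hc.ge
  · obtain ⟨x, hx, hx'⟩ := Finset.not_subset.1 hsub
    refine (Finset.eq_of_subset_of_card_le (fun y hy => ?_) hc.le).symm
    have hxC : x ∉ C := fun hxC => hx' (h'.down_of_closer hxC)
    have hxO : x ∉ O := fun hxO => h.up_of_opener x hxO hx
    by_cases hyC : y ∈ C
    · exact h.down_of_closer hyC
    have hyO : y ∉ O := fun hyO => h'.up_of_opener y hyO hy
    rcases Nat.lt_trichotomy x y with hxy | rfl | hxy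
    · exact absurd (h'.down_initial x y hxy hy hyC hxO) hx'
    · exact hx
    · exact h.down_initial y x hxy hx hxC hyO

theorem IsBallotPair.exists_word {a b : ℕ} {O C : Finset ℕ} (h : IsBallotPair (a + b) O C)
    (ha : C.card ≤ a) (hab : a ≤ b) :
    ∃ D ⊆ Finset.range (a + b), D.card = a ∧ IsCompatible (a + b) D O C := by
  set F := Finset.range (a + b) \ (O ∪ C) with hF
  have hdisj : Disjoint O C := Finset.disjoint_left.2 h.disj
  have hFc : F.card + (O.card + C.card) = a + b := by
    rw [← Finset.card_union_of_disjoint hdisj, hF,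
      Finset.card_sdiff_add_card_eq_card (Finset.union_subset h.openers_sub h.closers_sub),
      Finset.card_range]
  have hOC := h.card_eq
  have hFn : countBelow F (a + b) = F.card := countBelow_of_le Finset.sdiff_subset le_rfl
  -- The closers already supply `C.card` down letters; the first `a - C.card` unmatched positions
  -- supply the rest. Since `a ≤ b`, there are enough of them.
  obtain ⟨j, -, hj⟩ := exists_countBelow_eq F (k := a - C.card) (n := a + b)
    (by rw [hFn]; omega)
  have hmem : ∀ x, x ∈ F ↔ x < a + b ∧ x ∉ O ∧ x ∉ C := by
    intro x
    simp [hF]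
  refine ⟨C ∪ F.filter (· < j), ?_, ?_, h, Finset.subset_union_left, ?_, ?_⟩
  · exact Finset.union_subset h.closers_sub
      ((Finset.filter_subset _ _).trans Finset.sdiff_subset)
  · rw [Finset.card_union_of_disjoint, ← countBelow, hj]
    · omega
    · rw [Finset.disjoint_left]
      intro x hx hx'
      exact ((hmem x).1 (Finset.mem_filter.1 hx').1).2.2 hx
  · intro x hx hx'
    rcases Finset.mem_union.1 hx' with hx' | hx'
    · exact h.disj x hx hx'
    · exact ((hmem x).1 (Finset.mem_filter.1 hx').1).2.1 hx
  · intro x y hxy hy hyC hxO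
    rcases Finset.mem_union.1 hy with hy | hy
    · exact absurd hy hyC
    · rw [Finset.mem_filter, hmem] at hy
      by_cases hxC : x ∈ C
      · exact Finset.mem_union_left _ hxC
      · exact Finset.mem_union_right _
          (Finset.mem_filter.2 ⟨(hmem x).2 ⟨by omega, hxO, hxC⟩, by omega⟩)

/-- An unmatched position can follow neither an opener nor precede a closer directly, by the counts
in `fixed` and `le`; two adjacent unmatched letters form no peak by `down_initial`. -/
theorem IsCompatible.peakSet_eq {n : ℕ} {D O C : Finset ℕ} (h : IsCompatible n D O C) :
    peakSet D = {p | ∃ q, p = q + 1 ∧ q ∈ O ∧ q + 1 ∈ C} := by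
  ext p
  constructor
  · rintro ⟨q, rfl, hq, hq'⟩
    have hqC : q ∉ C := fun hx => hq (h.down_of_closer hx)
    have hqO' : q + 1 ∉ O := fun hx => h.up_of_opener _ hx hq'
    by_cases hqO : q ∈ O
    · refine ⟨q, rfl, hqO, ?_⟩
      by_contra hC
      have h1 := h.fixed _ hqO' hC
      rw [countBelow_succ_of_mem hqO, countBelow_succ_of_notMem hqC] at h1
      have := h.le q
      omega
    · exfalso
      by_cases hC : q + 1 ∈ C
      · have h1 := h.fixed q hqO hqC
        have h2 := h.le (q + 2)
        rw [countBelow_succ_of_mem hC, countBelow_succ_of_notMem hqC,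
          countBelow_succ_of_notMem hqO', countBelow_succ_of_notMem hqO] at h2
        omega
      · exact hq (h.down_initial q (q + 1) (by omega) hq' hC hqO)
  · rintro ⟨q, rfl, hq, hq'⟩
    exact ⟨q, rfl, h.up_of_opener q hq, h.down_of_closer hq'⟩

/-! ### `321`-avoiding involutions of the naturals -/

/-- The involution `g` of the naturals fixes everything from `n` on and avoids `321`. -/
structure IsAvoiding (n : ℕ) (g : ℕ → ℕ) : Prop where
  invol : ∀ x, g (g x) = x
  fix : ∀ x, n ≤ x → g x = x
  avoid : ∀ i j k, i < j → j < k → g j < g i → ¬ g k < g j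

/-- The points that `g` moves up. -/
def openers (n : ℕ) (g : ℕ → ℕ) : Finset ℕ := (Finset.range n).filter fun x => x < g x

/-- The points that `g` moves down. -/
def closers (n : ℕ) (g : ℕ → ℕ) : Finset ℕ := (Finset.range n).filter fun x => g x < x

namespace IsAvoiding

variable {n : ℕ} {g : ℕ → ℕ}

theorem inj (h : IsAvoiding n g) {x y : ℕ} (hxy : g x = g y) : x = y := by
  rw [← h.invol x, hxy, h.invol]

theorem mem_openers (h : IsAvoiding n g) {x : ℕ} : x ∈ openers n g ↔ x < g x := by
  rw [openers, Finset.mem_filter, Finset.mem_range, and_iff_right_iff_imp]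
  intro hx
  by_contra hn
  have := h.fix x (by omega)
  omega

theorem mem_closers (h : IsAvoiding n g) {x : ℕ} : x ∈ closers n g ↔ g x < x := by
  rw [closers, Finset.mem_filter, Finset.mem_range, and_iff_right_iff_imp]
  intro hx
  by_contra hn
  have := h.fix x (by omega)
  omega

/-- A larger value before `y` would begin a `321` pattern, ending at `g y` if `y` moves up and at `g
x` if `y` is fixed. -/
theorem lt_of_le_apply (h : IsAvoiding n g) {x y : ℕ} (hxy : x < y) (hy : y ≤ g y) :
    g x < g y := by
  by_contra hn
  have hne : g x ≠ g y := fun e => by have := h.inj e; omega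
  have hgy := h.invol y
  have hgx := h.invol x
  rcases Nat.lt_or_eq_of_le hy with hy | hy
  · exact h.avoid x y (g y) hxy hy (by omega) (by omega)
  · exact h.avoid x y (g x) hxy (by omega) (by omega) (by omega)

/-- The previous lemma read through the inverse, which is `g` itself. -/
theorem lt_of_apply_le (h : IsAvoiding n g) {x y : ℕ} (hxy : x < y) (hx : g x ≤ x) :
    g x < g y := by
  by_contra hn
  have hne : g x ≠ g y := fun e => by have := h.inj e; omega
  have := h.lt_of_le_apply (x := g y) (y := g x) (by omega) (by rw [h.invol]; exact hx)
  rw [h.invol, h.invol] at this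
  omega

theorem apply_mem_closers (h : IsAvoiding n g) {x : ℕ} (hx : x ∈ openers n g) :
    g x ∈ closers n g := by
  rw [h.mem_openers] at hx
  rw [h.mem_closers, h.invol]
  exact hx

theorem apply_mem_openers (h : IsAvoiding n g) {x : ℕ} (hx : x ∈ closers n g) :
    g x ∈ openers n g := by
  rw [h.mem_closers] at hx
  rw [h.mem_openers, h.invol]
  exact hx

theorem countBelow_openers_le (h : IsAvoiding n g) {i j : ℕ}
    (hij : ∀ x < i, x ∈ openers n g → g x < j) :
    countBelow (openers n g) i ≤ countBelow (closers n g) j := by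
  refine Finset.card_le_card_of_injOn g ?_ fun x _ y _ hxy => h.inj hxy
  intro x hx
  rw [Finset.mem_coe, Finset.mem_filter] at hx ⊢
  exact ⟨h.apply_mem_closers hx.1, hij x hx.2 hx.1⟩

theorem countBelow_closers_le (h : IsAvoiding n g) {i j : ℕ}
    (hij : ∀ x < i, x ∈ closers n g → g x < j) :
    countBelow (closers n g) i ≤ countBelow (openers n g) j := by
  refine Finset.card_le_card_of_injOn g ?_ fun x _ y _ hxy => h.inj hxy
  intro x hx
  rw [Finset.mem_coe, Finset.mem_filter] at hx ⊢
  exact ⟨h.apply_mem_openers hx.1, hij x hx.2 hx.1⟩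

theorem isBallotPair (h : IsAvoiding n g) : IsBallotPair n (openers n g) (closers n g) := by
  have hle : ∀ j, countBelow (closers n g) j ≤ countBelow (openers n g) j := by
    intro j
    refine h.countBelow_closers_le fun x hx hxc => ?_
    rw [h.mem_closers] at hxc
    omega
  refine ⟨Finset.filter_subset _ _, Finset.filter_subset _ _, ?_, hle, ?_⟩
  · intro x hx hx'
    rw [h.mem_openers] at hx
    rw [h.mem_closers] at hx'
    omega
  · intro j hj hj'
    rw [h.mem_openers] at hj
    rw [h.mem_closers] at hj'
    refine le_antisymm (h.countBelow_openers_le fun x hx _ => ?_) (hle j)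
    have := h.lt_of_le_apply hx (by omega)
    omega

/-- Arcs do not nest: `g` preserves the order of openers and of closers. Hence the two sets
determine `g`. -/
theorem countBelow_apply (h : IsAvoiding n g) {x : ℕ} (hx : x ∈ openers n g) :
    countBelow (closers n g) (g x) = countBelow (openers n g) x := by
  have hx' := h.mem_openers.1 hx
  refine le_antisymm (h.countBelow_closers_le fun y hy hyc => ?_)
    (h.countBelow_openers_le fun y hy _ => h.lt_of_le_apply hy hx'.le)
  have := h.lt_of_apply_le hy (h.mem_closers.1 hyc).le
  rwa [h.invol] at this

theorem eq_of_openers_eq {g' : ℕ → ℕ} (h : IsAvoiding n g) (h' : IsAvoiding n g')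
    (hO : openers n g = openers n g') (hC : closers n g = closers n g') : g = g' := by
  have key : ∀ x ∈ openers n g, g x = g' x := by
    intro x hx
    have hx' : x ∈ openers n g' := hO ▸ hx
    refine countBelow_inj (h.apply_mem_closers hx) (hC ▸ h'.apply_mem_closers hx') ?_
    rw [h.countBelow_apply hx, hC, h'.countBelow_apply hx', hO]
  funext x
  rcases Nat.lt_trichotomy x (g x) with hx | hx | hx
  · exact key x (h.mem_openers.2 hx)
  · have h1 : x ∉ openers n g' := by rw [← hO, h.mem_openers]; omega
    have h2 : x ∉ closers n g' := by rw [← hC, h.mem_closers]; omega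
    rw [h'.mem_openers] at h1
    rw [h'.mem_closers] at h2
    omega
  · have := key (g x) (h.apply_mem_openers (h.mem_closers.2 hx))
    rw [h.invol] at this
    nth_rewrite 2 [this]
    rw [h'.invol]

theorem descent_iff (h : IsAvoiding n g) (p : ℕ) :
    g (p + 1) < g p ↔ p ∈ openers n g ∧ p + 1 ∈ closers n g := by
  rw [h.mem_openers, h.mem_closers]
  constructor
  · intro hp
    constructor
    · by_contra hn
      have := h.lt_of_apply_le (Nat.lt_succ_self p) (by omega)
      simp only [Nat.succ_eq_add_one] at this
      omega
    · by_contra hn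
      have := h.lt_of_le_apply (Nat.lt_succ_self p) (by simp only [Nat.succ_eq_add_one]; omega)
      simp only [Nat.succ_eq_add_one] at this
      omega
  · rintro ⟨h1, h2⟩
    omega

end IsAvoiding

/-! ### The nonnesting matching of a ballot pair -/

open Classical in
/-- The involution that exchanges the `i`-th opener and the `i`-th closer for all `i`. -/
noncomputable def matching (O C : Finset ℕ) (x : ℕ) : ℕ :=
  if x ∈ O then partner O C x else if x ∈ C then partner C O x else x

namespace IsBallotPair

variable {n : ℕ} {O C : Finset ℕ}

theorem matching_opener (h : IsBallotPair n O C) {x : ℕ} (hx : x ∈ O) :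
    matching O C x ∈ C ∧ countBelow C (matching O C x) = countBelow O x := by
  rw [matching, if_pos hx]
  exact partner_spec h.card_eq hx

theorem matching_closer (h : IsBallotPair n O C) {x : ℕ} (hx : x ∈ C) :
    matching O C x ∈ O ∧ countBelow O (matching O C x) = countBelow C x := by
  rw [matching, if_neg fun hx' => h.disj x hx' hx, if_pos hx]
  exact partner_spec h.card_eq.symm hx

theorem matching_fixed {x : ℕ} (hx : x ∉ O) (hx' : x ∉ C) : matching O C x = x := by
  rw [matching, if_neg hx, if_neg hx']

theorem matching_matching (h : IsBallotPair n O C) (x : ℕ) :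
    matching O C (matching O C x) = x := by
  by_cases hx : x ∈ O
  · have h1 := h.matching_opener hx
    have h2 := h.matching_closer h1.1
    exact countBelow_inj h2.1 hx (h2.2.trans h1.2)
  by_cases hx' : x ∈ C
  · have h1 := h.matching_closer hx'
    have h2 := h.matching_opener h1.1
    exact countBelow_inj h2.1 hx' (h2.2.trans h1.2)
  rw [matching_fixed hx hx', matching_fixed hx hx']

theorem lt_of_countBelow_lt {S : Finset ℕ} {i j : ℕ} (h : countBelow S i < countBelow S j) :
    i < j := by
  by_contra hn
  have := countBelow_mono S (show j ≤ i by omega)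
  omega

theorem lt_matching (h : IsBallotPair n O C) {x : ℕ} (hx : x ∈ O) : x < matching O C x := by
  have h1 := h.matching_opener hx
  have hne : x ≠ matching O C x := fun e => h.disj x hx (e ▸ h1.1)
  by_contra hn
  have h2 := countBelow_lt h1.1 (show matching O C x < x by omega)
  have := h.le x
  omega

theorem matching_lt (h : IsBallotPair n O C) {x : ℕ} (hx : x ∈ C) : matching O C x < x := by
  have := h.lt_matching (h.matching_closer hx).1
  rwa [h.matching_matching] at this

theorem lt_matching_iff (h : IsBallotPair n O C) {x : ℕ} : x < matching O C x ↔ x ∈ O := by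
  refine ⟨fun hx => ?_, h.lt_matching⟩
  by_contra hO
  by_cases hC : x ∈ C
  · have := h.matching_lt hC; omega
  · rw [matching_fixed hO hC] at hx; omega

theorem matching_lt_iff (h : IsBallotPair n O C) {x : ℕ} : matching O C x < x ↔ x ∈ C := by
  refine ⟨fun hx => ?_, h.matching_lt⟩
  by_contra hC
  by_cases hO : x ∈ O
  · have := h.lt_matching hO; omega
  · rw [matching_fixed hO hC] at hx; omega

theorem matching_lt_matching (h : IsBallotPair n O C) {x y : ℕ} (hxy : x < y) (hy : y ∉ C) :
    matching O C x < matching O C y := by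
  have hyle : y ≤ matching O C y := by
    by_contra hn
    exact hy (h.matching_lt_iff.1 (by omega))
  by_cases hx : x ∈ O
  · have h1 := h.matching_opener hx
    have h2 := countBelow_lt hx hxy
    by_cases hyO : y ∈ O
    · have h3 := h.matching_opener hyO
      exact lt_of_countBelow_lt (S := C) (by omega)
    · have h3 := h.fixed y hyO hy
      rw [matching_fixed hyO hy]
      exact lt_of_countBelow_lt (S := C) (by omega)
  · have : ¬ x < matching O C x := fun hlt => hx (h.lt_matching_iff.1 hlt)
    omega

theorem isAvoiding_matching (h : IsBallotPair n O C) : IsAvoiding n (matching O C) := by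
  refine ⟨h.matching_matching, ?_, ?_⟩
  · intro x hx
    apply matching_fixed
    · intro hx'; have := Finset.mem_range.1 (h.openers_sub hx'); omega
    · intro hx'; have := Finset.mem_range.1 (h.closers_sub hx'); omega
  · intro i j k hij hjk hlt hlt'
    -- The middle entry decides: if it is not a closer, nothing larger precedes it; if it is one,
    -- nothing smaller follows it.
    by_cases hj : j ∈ C
    · by_cases hk : k ∈ C
      · have h1 := h.matching_closer hj
        have h2 := h.matching_closer hk
        have h3 := countBelow_lt hj hjk
        have := lt_of_countBelow_lt (S := O)
          (show countBelow O (matching O C j) < countBelow O (matching O C k) by omega)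
        omega
      · have := h.matching_lt_matching hjk hk
        omega
    · have := h.matching_lt_matching hij hj
      omega

theorem openers_matching (h : IsBallotPair n O C) : openers n (matching O C) = O := by
  ext x
  rw [h.isAvoiding_matching.mem_openers, h.lt_matching_iff]

theorem closers_matching (h : IsBallotPair n O C) : closers n (matching O C) = C := by
  ext x
  rw [h.isAvoiding_matching.mem_closers, h.matching_lt_iff]

end IsBallotPair

/-! ### Permutations of `Fin n` -/

/-- The extension of a permutation of `Fin n` to the naturals by fixed points. -/
def natExtend {n : ℕ} (π : Equiv.Perm (Fin n)) (x : ℕ) : ℕ :=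
  if h : x < n then π ⟨x, h⟩ else x

section natExtend

variable {n : ℕ} {π : Equiv.Perm (Fin n)}

theorem natExtend_val (π : Equiv.Perm (Fin n)) (x : Fin n) : natExtend π x = π x := by
  simp [natExtend]

theorem natExtend_of_le (π : Equiv.Perm (Fin n)) {x : ℕ} (h : n ≤ x) : natExtend π x = x := by
  simp [natExtend, h]

theorem natExtend_injective : Function.Injective (natExtend (n := n)) := by
  intro π π' h
  ext x
  rw [← natExtend_val, h, natExtend_val]

theorem containsPattern321_iff :
    ContainsPattern π pattern321 ↔ ∃ i j k : Fin n, i < j ∧ j < k ∧ π j < π i ∧ π k < π j := by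
  constructor
  · rintro ⟨f, hf, h⟩
    refine ⟨f 0, f 1, f 2, hf (by decide), hf (by decide), (h 1 0).2 (by decide),
      (h 2 1).2 (by decide)⟩
  · rintro ⟨i, j, k, hij, hjk, h1, h2⟩
    have h3 := h2.trans h1
    refine ⟨![i, j, k], ?_, ?_⟩
    · intro x y hxy
      fin_cases x <;> fin_cases y <;> simp_all
      exact hij.trans hjk
    · intro x y
      fin_cases x <;> fin_cases y <;>
        simp [pattern321, Fin.rev, h1, h2, h3, h1.le, h2.le, h3.le]

theorem isAvoiding_natExtend (hπ : π ∈ avoidingInvolutions n) :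
    IsAvoiding n (natExtend π) := by
  obtain ⟨hinv, hav⟩ := hπ
  have hfix : ∀ x, n ≤ x → natExtend π x = x := fun x hx => natExtend_of_le π hx
  have hlt : ∀ x, x < n → natExtend π x < n := fun x hx => by
    rw [show x = ((⟨x, hx⟩ : Fin n) : ℕ) from rfl, natExtend_val]
    exact (π _).2
  refine ⟨fun x => ?_, hfix, fun i j k hij hjk h1 h2 => ?_⟩
  · by_cases hx : x < n
    · lift x to Fin n using hx
      rw [natExtend_val, natExtend_val, hinv]
    · rw [hfix x (by omega), hfix x (by omega)]
  -- A fixed point from `n` on exceeds all earlier values, so it cannot end a `321` pattern.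
  · have hk : k < n := by
      by_contra hk
      have := hfix k (by omega)
      by_cases hj : j < n
      · have := hlt j hj
        omega
      · have := hfix j (by omega)
        omega
    have hj := hjk.trans hk
    have hi := hij.trans hj
    lift i to Fin n using hi
    lift j to Fin n using hj
    lift k to Fin n using hk
    simp only [natExtend_val, Fin.val_fin_lt] at *
    exact hav (containsPattern321_iff.2 ⟨i, j, k, hij, hjk, h1, h2⟩)

theorem exists_natExtend_eq {g : ℕ → ℕ} (h : IsAvoiding n g) :
    ∃ π ∈ avoidingInvolutions n, natExtend π = g := by
  have hlt : ∀ x, x < n → g x < n := by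
    intro x hx
    by_contra hn
    have := h.fix (g x) (by omega)
    rw [h.invol] at this
    omega
  let f : Fin n → Fin n := fun x => ⟨g x, hlt x x.2⟩
  have hf : Function.Involutive f := fun x => Fin.ext (h.invol x)
  refine ⟨hf.toPerm, ⟨hf, ?_⟩, ?_⟩
  · rw [containsPattern321_iff]
    rintro ⟨i, j, k, hij, hjk, h1, h2⟩
    exact h.avoid i j k hij hjk h1 h2
  · funext x
    by_cases hx : x < n
    · lift x to Fin n using hx
      rw [natExtend_val]
      rfl
    · rw [natExtend_of_le _ (by omega), h.fix x (by omega)]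

theorem descentSet_eq (hπ : π ∈ avoidingInvolutions n) :
    descentSet π = {p | ∃ q, p = q + 1 ∧ q ∈ openers n (natExtend π) ∧
      q + 1 ∈ closers n (natExtend π)} := by
  have h := isAvoiding_natExtend hπ
  ext p
  simp only [← h.descent_iff, descentSet, Set.mem_ofPred_eq]
  constructor
  · rintro ⟨j, k, rfl, hk, hlt⟩
    refine ⟨j, rfl, ?_⟩
    rw [← hk, natExtend_val, natExtend_val]
    exact hlt
  · rintro ⟨q, rfl, hlt⟩
    have hq := ((Finset.mem_filter.1 ((h.descent_iff q).1 hlt).2).1)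
    rw [Finset.mem_range] at hq
    refine ⟨⟨q, by omega⟩, ⟨q + 1, hq⟩, rfl, rfl, ?_⟩
    rw [Fin.lt_def, ← natExtend_val, ← natExtend_val]
    exact hlt

/-- This turns the bound on fixed points into the bound `a` on the number of closers. -/
theorem fixedPointCount_add (hπ : π ∈ avoidingInvolutions n) :
    fixedPointCount π + 2 * (closers n (natExtend π)).card = n := by
  have h := isAvoiding_natExtend hπ
  have hc := h.isBallotPair.card_eq
  have hfp : fixedPointCount π =
      ((Finset.range n).filter fun x => natExtend π x = x).card := by
    rw [fixedPointCount, ← Finset.card_map Fin.valEmbedding]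
    congr 1
    ext x
    simp only [Finset.mem_map, Finset.mem_filter, Finset.mem_univ, true_and, Finset.mem_range,
      Fin.valEmbedding_apply]
    constructor
    · rintro ⟨y, hy, rfl⟩
      exact ⟨y.2, by rw [natExtend_val, hy]⟩
    · rintro ⟨hx, hxe⟩
      lift x to Fin n using hx
      exact ⟨x, Fin.ext (by rwa [natExtend_val] at hxe), rfl⟩
  have h1 := Finset.card_filter_add_card_filter_not (s := Finset.range n)
    (fun x => natExtend π x = x)
  have h2 : (Finset.range n).filter (fun x => ¬ natExtend π x = x) =
      openers n (natExtend π) ∪ closers n (natExtend π) := by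
    ext x
    simp only [openers, closers, Finset.mem_filter, Finset.mem_union, Finset.mem_range]
    omega
  rw [h2, Finset.card_union_of_disjoint (Finset.disjoint_left.2 h.isBallotPair.disj),
    ← hfp, Finset.card_range] at h1
  omega

end natExtend

/-! ### From involutions through words to diagrams -/

theorem exists_equiv_word (a b : ℕ) (hab : a ≤ b) :
    ∃ f : {π : Equiv.Perm (Fin (a + b)) //
          π ∈ avoidingInvolutions (a + b) ∧ b - a ≤ fixedPointCount π} → LatticeWord a b,
      Function.Bijective f ∧ ∀ π, descentSet π.1 = peakSet (f π).1 := by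
  have hex : ∀ π : {π : Equiv.Perm (Fin (a + b)) //
      π ∈ avoidingInvolutions (a + b) ∧ b - a ≤ fixedPointCount π},
      ∃ D : LatticeWord a b, IsCompatible (a + b) D.1 (openers (a + b) (natExtend π.1))
        (closers (a + b) (natExtend π.1)) := by
    rintro ⟨π, hπ, hfp⟩
    have h1 := fixedPointCount_add hπ
    obtain ⟨D, hD, hc, h⟩ :=
      (isAvoiding_natExtend hπ).isBallotPair.exists_word (by omega) hab
    exact ⟨⟨D, hD, hc⟩, h⟩
  choose f hf using hex
  refine ⟨f, ⟨fun π π' h => ?_, fun D => ?_⟩, fun π => ?_⟩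
  · have h1 := hf π
    rw [h] at h1
    obtain ⟨hO, hC⟩ := h1.unique (hf π')
    exact Subtype.ext (natExtend_injective
      ((isAvoiding_natExtend π.2.1).eq_of_openers_eq (isAvoiding_natExtend π'.2.1) hO hC))
  · obtain ⟨O, C, h⟩ := exists_isCompatible (a + b) D.2.1
    obtain ⟨π, hπ, hg⟩ := exists_natExtend_eq h.isAvoiding_matching
    have hO : openers (a + b) (natExtend π) = O := by rw [hg, h.openers_matching]
    have hC : closers (a + b) (natExtend π) = C := by rw [hg, h.closers_matching]
    have h1 := fixedPointCount_add hπ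
    -- All closers are among the `a` down letters, so the involution has at least `b - a` fixed
    -- points.
    have h2 := Finset.card_le_card h.down_of_closer
    rw [D.2.2] at h2
    rw [hC] at h1
    refine ⟨⟨π, hπ, by omega⟩, Subtype.ext ?_⟩
    have h3 := hf ⟨π, hπ, by omega⟩
    dsimp only at h3
    rw [hO, hC] at h3
    exact h3.word_unique h ((f _).2.2.trans D.2.2.symm)
  · rw [descentSet_eq π.2.1, (hf π).peakSet_eq]

theorem theorem6p2 (a b : ℕ) (hab : a ≤ b) :
    ∃ θ : {π : Equiv.Perm (Fin (a + b)) //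
          π ∈ avoidingInvolutions (a + b) ∧ b - a ≤ fixedPointCount π} →
        {μ : YoungDiagram // μ ∈ diagramsInRectangle a b},
      Function.Bijective θ ∧
        ∀ π, descentSet π.1 = hookDecomposition (θ π).1 := by
  obtain ⟨f, hf, hfs⟩ := exists_equiv_word a b hab
  obtain ⟨e, he⟩ := hasHookRecursion_word.exists_equiv hasHookRecursion_diagram a b
  exact ⟨e ∘ f, e.bijective.comp hf, fun π => (hfs π).trans (he (f π))⟩
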